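/- All topological spaces and topological groups are assumed to be Hausdorff. A continuous map is called *perfect* if it is closed, onto, and all its fibers are compact. A topological group $G$ is called - *feathered* if it contains a non-empty compact subset $K$ of countable character in $G$, i.e. there is a countable family of open sets containing $K$ such that every open set containing $K$ includes a member of the family; - *$\mathbb{R}$-factorizable* if for every continuous function $f\colon G\to\mathbb{R}$ there exist a continuous homomorphism $\pi\colon G\to H$ onto a second-countable topological group $H$ and a continuous function $g\colon H\to\mathbb{R}$ such that $f=g\circ\pi$; - *$P\mathbb{R}$-factorizable* if for every continuous function $f\colon G\to\mathbb{R}$ there exist a perfect homomorphism $\pi\colon G\to H$ onto a second-countable topological group $H$ and a continuous function $g\colon H\to\mathbb{R}$ such that $f=g\circ\pi$. Then a topological group $G$ is $P\mathbb{R}$-factorizable if and only if $G$ is feathered and $\mathbb{R}$-factorizable. -/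

import Mathlib

open scoped Topology

universe u

/-- A perfect map: a continuous closed map onto its codomain, all of whose fibers are compact. -/
structure IsPerfectMap {X Y : Type*} [TopologicalSpace X] [TopologicalSpace Y]
    (f : X → Y) : Prop where
  continuous : Continuous f
  isClosedMap : IsClosedMap f
  surjective : Function.Surjective f
  isCompact_fiber : ∀ y : Y, IsCompact (f ⁻¹' {y})

/-- A topological group is feathered if it contains a nonempty compact set `K` of countable
character: the neighborhoods of `K` have a countable base. -/
def IsFeathered (G : Type u) [Group G] [TopologicalSpace G] [IsTopologicalGroup G] : Prop :=
  ∃ K : Set G, K.Nonempty ∧ IsCompact K ∧ (𝓝ˢ K).IsCountablyGenerated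

/-- A topological group `G` is `ℝ`-factorizable if every continuous real-valued function on `G`
factors, through a continuous function, over a continuous homomorphism of `G` onto a
second-countable (Hausdorff) topological group. As `H` is an image of `G`, the restriction of `H`
to the universe of `G` loses nothing. -/
def IsRFactorizable (G : Type u) [Group G] [TopologicalSpace G] [IsTopologicalGroup G] : Prop :=
  ∀ f : G → ℝ, Continuous f →
    ∃ (H : Type u) (_ : Group H) (_ : TopologicalSpace H) (π : G →* H) (g : H → ℝ),
      IsTopologicalGroup H ∧ T2Space H ∧ SecondCountableTopology H ∧
        Continuous π ∧ Function.Surjective π ∧ Continuous g ∧ f = g ∘ π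

/-- A topological group `G` is `Pℝ`-factorizable if every continuous real-valued function on `G`
factors, through a continuous function, over a perfect homomorphism of `G` onto a
second-countable (Hausdorff) topological group. -/
def IsPRFactorizable (G : Type u) [Group G] [TopologicalSpace G] [IsTopologicalGroup G] : Prop :=
  ∀ f : G → ℝ, Continuous f →
    ∃ (H : Type u) (_ : Group H) (_ : TopologicalSpace H) (π : G →* H) (g : H → ℝ),
      IsTopologicalGroup H ∧ T2Space H ∧ SecondCountableTopology H ∧
        IsPerfectMap π ∧ Continuous g ∧ f = g ∘ π

/-! If `G` is feathered by `K` with countable neighborhood base `U n`, fix `k ∈ K` and continuous `e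
n` vanishing at `k` with `{e n < 1} ⊆ U n`. Factor `f` and all `e n` through one `π` onto a
second-countable group: each `U n` then contains the preimage of a neighborhood of `π k`.
Compactness of `K` and translation make `π` proper. Conversely, the kernel of a perfect homomorphism
feathers `G`. -/

/-- An ultrafilter converging to a compact set converges to one of its points. -/
theorem IsCompact.exists_ultrafilter_le_nhds {X : Type*} [TopologicalSpace X] {K : Set X}
    (hK : IsCompact K) {F : Ultrafilter X} (hF : (F : Filter X) ≤ 𝓝ˢ K) :
    ∃ x ∈ K, (F : Filter X) ≤ 𝓝 x := by
  by_contra! h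
  have h' : ∀ x ∈ K, ∃ s ∈ 𝓝 x, s ∉ F := fun x hx => by
    simpa [Filter.not_le] using h x hx
  choose! s hs hsF using h'
  obtain ⟨t, ht, htK⟩ := hK.elim_nhds_subcover (fun x => interior (s x))
    (fun x hx => interior_mem_nhds.2 (hs x hx))
  have hmem : (⋃ x ∈ t, interior (s x)) ∈ F :=
    hF ((isOpen_biUnion fun _ _ => isOpen_interior).mem_nhdsSet.2 htK)
  obtain ⟨x, hxt, hx⟩ := (Ultrafilter.finite_biUnion_mem_iff t.finite_toSet).1 hmem
  exact hsF x (ht x hxt) (Filter.mem_of_superset hx interior_subset)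

theorem IsPerfectMap.of_isProperMap {X Y : Type*} [TopologicalSpace X] [TopologicalSpace Y]
    {f : X → Y} (hf : IsProperMap f) (hsurj : Function.Surjective f) : IsPerfectMap f :=
  ⟨hf.continuous, hf.isClosedMap, hsurj, fun _ => hf.isCompact_preimage isCompact_singleton⟩

theorem IsPRFactorizable.isRFactorizable {G : Type u} [Group G] [TopologicalSpace G]
    [IsTopologicalGroup G] (h : IsPRFactorizable G) : IsRFactorizable G := fun f hf => by
  obtain ⟨H, i₁, i₂, π, g, hG, hT, hS, hπ, hg, hfg⟩ := h f hf
  exact ⟨H, i₁, i₂, π, g, hG, hT, hS, hπ.continuous, hπ.surjective, hg, hfg⟩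

theorem IsPRFactorizable.isFeathered {G : Type u} [Group G] [TopologicalSpace G]
    [IsTopologicalGroup G] (h : IsPRFactorizable G) : IsFeathered G := by
  obtain ⟨H, _, _, π, g, _, _, _, hπ, -, -⟩ := h (fun _ => 0) continuous_const
  refine ⟨π ⁻¹' {1}, ⟨1, map_one π⟩, hπ.isCompact_fiber 1, ?_⟩
  -- As `π` is closed, neighborhoods of the kernel are pulled back from those of `1`, which have a
  -- countable base.
  rw [← hπ.isClosedMap.comap_nhds_eq hπ.continuous]
  infer_instance

/-- A continuous homomorphism to a Hausdorff group is proper as soon as, at one point, the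
preimages of neighborhoods converge to a compact set. -/
theorem MonoidHom.isProperMap_of_comap_nhds_le {G H : Type*} [Group G] [TopologicalSpace G]
    [IsTopologicalGroup G] [Group H] [TopologicalSpace H] [IsTopologicalGroup H] [T2Space H]
    {π : G →* H} (hπ : Continuous π) (hsurj : Function.Surjective π) {K : Set G}
    (hK : IsCompact K) {k : G} (hk : Filter.comap π (𝓝 (π k)) ≤ 𝓝ˢ K) : IsProperMap π := by
  refine isProperMap_iff_ultrafilter.2 ⟨hπ, fun F y hF => ?_⟩
  obtain ⟨a, rfl⟩ := hsurj y
  -- Left translation moves the limit `π a` to `π k`, where `hk` applies.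
  let F' : Ultrafilter G := F.map (fun x => k * a⁻¹ * x)
  have hF' : Filter.Tendsto π F' (𝓝 (π k)) := by
    have := hF.const_mul (π (k * a⁻¹))
    rw [← map_mul, inv_mul_cancel_right] at this
    rw [Ultrafilter.coe_map, Filter.tendsto_map'_iff]
    simpa [Function.comp_def, mul_assoc] using this
  obtain ⟨x, -, hx⟩ := hK.exists_ultrafilter_le_nhds ((Filter.map_le_iff_le_comap.1 hF').trans hk)
  have hπx : π x = π k := tendsto_nhds_unique ((hπ.tendsto x).mono_left hx) hF'
  refine ⟨a * k⁻¹ * x, by simp [hπx], ?_⟩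
  have h2 : Filter.Tendsto (fun x => k * a⁻¹ * x) F (𝓝 x) := hx
  simpa [mul_assoc, Filter.Tendsto] using h2.const_mul (a * k⁻¹)

theorem IsTopologicalGroup.exists_continuous_lt_one_subset {G : Type*} [Group G]
    [TopologicalSpace G] [IsTopologicalGroup G] {x : G} {U : Set G} (hU : U ∈ 𝓝 x) :
    ∃ f : G → ℝ, Continuous f ∧ f x = 0 ∧ {y | f y < 1} ⊆ U := by
  let := IsTopologicalGroup.rightUniformSpace G
  obtain ⟨f, hf, hfx, hfU⟩ := CompletelyRegularSpace.completely_regular x (interior U)ᶜ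
    isOpen_interior.isClosed_compl (by simpa using mem_interior_iff_mem_nhds.2 hU)
  refine ⟨fun y => f y, by fun_prop, by simp [hfx], fun y hy => ?_⟩
  by_contra hyU
  have : f y = 1 := hfU fun h => hyU (interior_subset h)
  simp [this] at hy

/-- In an `ℝ`-factorizable group, countably many continuous functions factor simultaneously over
one continuous homomorphism onto a second-countable group. -/
theorem IsRFactorizable.exists_factorization_countable {G : Type u} [Group G]
    [TopologicalSpace G] [IsTopologicalGroup G] (h : IsRFactorizable G) {ι : Type} [Countable ι]
    (f : ι → G → ℝ) (hf : ∀ i, Continuous (f i)) :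
    ∃ (H : Type u) (_ : Group H) (_ : TopologicalSpace H) (π : G →* H) (g : ι → H → ℝ),
      IsTopologicalGroup H ∧ T2Space H ∧ SecondCountableTopology H ∧
        Continuous π ∧ Function.Surjective π ∧ ∀ i, Continuous (g i) ∧ f i = g i ∘ π := by
  choose H i₁ i₂ π g hG hT hS hπ _ hg hfg using fun i => h (f i) (hf i)
  -- The diagonal image lies in a countable product, hence is second-countable.
  let p : G →* ∀ i, H i := MonoidHom.pi π
  have hp : Continuous p := continuous_pi hπ
  have : SecondCountableTopology p.range :=
    TopologicalSpace.Subtype.secondCountableTopology (p.range : Set (∀ i, H i))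
  exact ⟨p.range, inferInstance, inferInstance, p.rangeRestrict, fun i y => g i (y.1 i),
    inferInstance, inferInstance, inferInstance, hp.subtype_mk _, p.rangeRestrict_surjective,
    fun i => ⟨(hg i).comp ((continuous_apply i).comp continuous_subtype_val), hfg i⟩⟩

theorem IsRFactorizable.isPRFactorizable {G : Type u} [Group G] [TopologicalSpace G]
    [IsTopologicalGroup G] (h : IsRFactorizable G) (hG : IsFeathered G) :
    IsPRFactorizable G := fun f hf => by
  obtain ⟨K, ⟨k, hkK⟩, hK, hc⟩ := hG
  obtain ⟨U, hU⟩ := (𝓝ˢ K).exists_antitone_basis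
  choose e he hek heU using fun n => IsTopologicalGroup.exists_continuous_lt_one_subset
    (nhds_le_nhdsSet hkK (hU.mem n))
  -- Index `none` carries `f`, and `some n` carries `e n`.
  obtain ⟨H, _, _, π, g, _, _, hS, hπ, hsurj, hg⟩ := h.exists_factorization_countable
    (fun i : Option ℕ => i.elim f e) (fun i => by cases i; exacts [hf, he _])
  refine ⟨H, _, _, π, g none, ‹_›, ‹_›, hS, .of_isProperMap
    (MonoidHom.isProperMap_of_comap_nhds_le hπ hsurj hK (k := k) ?_) hsurj, hg none⟩
  refine hU.ge_iff.2 fun n _ => ?_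
  have hgn : ∀ x, e n x = g (some n) (π x) := congrFun (hg (some n)).2
  have hlt : g (some n) (π k) < 1 := by rw [← hgn, hek]; exact one_pos
  refine Filter.mem_of_superset (Filter.preimage_mem_comap
    ((hg (some n)).1.continuousAt.eventually_lt_const hlt)) fun x hx => heU n ?_
  simpa [hgn] using hx

theorem corollary3p5 (G : Type u) [Group G] [TopologicalSpace G] [IsTopologicalGroup G]
    [T2Space G] :
    IsPRFactorizable G ↔ IsFeathered G ∧ IsRFactorizable G :=
  ⟨fun h => ⟨h.isFeathered, h.isRFactorizable⟩, fun h => h.2.isPRFactorizable h.1⟩
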